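/- Consider an episodic Markov decision process with countable state space $\mathcal S$ and countable action space $\mathcal A$, initial distribution $\mu$, transition kernel $P(\cdot\mid s,a)$, a set $\mathcal T\subset\mathcal S$ of terminal states, and a subset of $\mathcal T$ of successful terminal states. A policy $\pi$ generates a trajectory by $S_1\sim\mu$, $A_t\sim\pi(\cdot\mid S_t)$, $S_{t+1}\sim P(\cdot\mid S_t,A_t)$; the episode ends at the first time $T$ with $S_T\in\mathcal T$, and $R\in\{0,1\}$ indicates whether it ends, and ends in a successful terminal state. Write $P_\pi$, $\mathbb E_\pi$ for the law of the trajectory and its expectation, and $$\rho(\pi)=P_\pi(R=1),\qquad d_\pi(s)=\mathbb E_\pi\Big[\sum_{t=1}^{T-1}1(S_t=s)\Big],\qquad d^+_\pi(s)=\mathbb E_\pi\Big[\sum_{t=1}^{T-1}1(S_t=s)\,\Big|\,R=1\Big]$$ for non-terminal states $s$. Let $\pi_0$ be a (behavior) policy under which success has positive probability from every non-terminal state, let $\pi_+(a\mid s)=P_{\pi_0}(A_t=a\mid S_t=s,\,R=1)$ be its success-conditioned policy, and for a policy $\pi$ let $$\ell(\pi)=\mathbb E_{\pi_0}\Big[-\sum_{t=1}^{T-1}\log\pi(A_t\mid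 S_t)\,\Big|\,R=1\Big]\in[0,\infty]$$ be its cross-entropy loss on successful trajectories of $\pi_0$. Assume $\ell(\pi_+)<\infty$, and put $$M=\sup_{s\notin\mathcal T}\frac{d_{\pi_+}(s)}{d^+_{\pi_0}(s)}\in[0,\infty]$$ (states where both occupancies vanish are ignored). Then every policy $\hat\pi$ has non-negative excess loss $\Delta=\ell(\hat\pi)-\ell(\pi_+)\in[0,\infty]$ and satisfies $$|\rho(\hat\pi)-\rho(\pi_+)|\le\sqrt{M\,\Delta/2}$$ (with the convention $0\cdot\infty=0$). -/

import Mathlib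

open MeasureTheory ProbabilityTheory
open scoped ENNReal

/-- An episodic Markov decision process with discrete states `S` and actions `A`: an initial state
distribution, a transition kernel, a set of terminal states, and the subset of those terminal
states that count as a success (the remaining terminal states are failures). -/
structure EpisodicMDP (S A : Type*) where
  /-- distribution of the first state -/
  init : PMF S
  /-- `trans s a` is the distribution of the next state after action `a` in state `s` -/
  trans : S → A → PMF S
  /-- terminal states -/
  terminal : Set S
  /-- successful terminal states -/
  success : Set S
  success_subset : success ⊆ terminal

namespace EpisodicMDP

/-- A Markovian (stationary, randomized) policy; `π s a` is the probability of action `a` in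
state `s`. (The values at terminal states are never used.) -/
abbrev Policy (S A : Type*) := S → PMF A

/-- The law of a state-action pair `(s, a)` with `s` drawn from `ν` and `a` drawn from `π s`. -/
noncomputable def stateAction {S A : Type*} (ν : PMF S) (π : Policy S A) : PMF (S × A) :=
  ν.bind fun s => (π s).map fun a => (s, a)

/-- A state-action sequence `ω` lists the pairs (state, action) at the times `0, 1, 2, …`.
`M.Running ω t` says that no terminal state has been reached up to and including time `t`: in terms
of the first time `T` at which the state is terminal, it says `t < T`. -/
def Running {S A : Type*} (M : EpisodicMDP S A) (ω : ℕ → S × A) (t : ℕ) : Prop :=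
  ∀ k ≤ t, (ω k).1 ∉ M.terminal

/-- The success event `R = 1`: the episode ends, and the first terminal state is a successful
one. -/
def Success {S A : Type*} (M : EpisodicMDP S A) : Set (ℕ → S × A) :=
  {ω | ∃ n, (∀ k < n, (ω k).1 ∉ M.terminal) ∧ (ω n).1 ∈ M.success}

open Classical in
/-- The number of times the trajectory visits the state `s` before the episode ends. -/
noncomputable def visits {S A : Type*} (M : EpisodicMDP S A) (s : S) (ω : ℕ → S × A) : ℝ≥0∞ :=
  ∑' t : ℕ, if M.Running ω t ∧ (ω t).1 = s then 1 else 0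

/-- `-log p` as an element of `[0, ∞]`, for a probability `p`; it is `∞` at `p = 0`. -/
noncomputable def negLog (p : ℝ≥0∞) : ℝ≥0∞ := (-ENNReal.log p).toENNReal

open Classical in
/-- The next-action prediction loss of `π` on one trajectory: the sum of `-log π(a_t | s_t)` over
all the actions taken before the episode ends. -/
noncomputable def trajLoss {S A : Type*} (M : EpisodicMDP S A) (π : Policy S A)
    (ω : ℕ → S × A) : ℝ≥0∞ :=
  ∑' t : ℕ, if M.Running ω t then negLog (π (ω t).1 (ω t).2) else 0

section Law

variable {S A : Type*} [Countable S] [MeasurableSpace S] [MeasurableSingletonClass S]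
  [Countable A] [MeasurableSpace A] [MeasurableSingletonClass A]
  (M : EpisodicMDP S A)

/-- One step of the state-action chain under `π`: from `(s, a)` the next state is drawn from the
transition kernel and the next action from `π` at that state. -/
noncomputable def stepKernel (π : Policy S A) : Kernel (S × A) (S × A) :=
  Kernel.ofFunOfCountable fun x => (stateAction (M.trans x.1 x.2) π).toMeasure

instance (π : Policy S A) : IsMarkovKernel (M.stepKernel π) :=
  ⟨fun x => by
    change IsProbabilityMeasure (stateAction (M.trans x.1 x.2) π).toMeasure
    infer_instance⟩

/-- The law of the state-action sequence when the first state is drawn from `ν` and the actions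
are drawn from `π`. The sequence is formally continued after a terminal state has been reached;
all the quantities below depend only on what happens up to that time. -/
noncomputable def lawFrom (ν : PMF S) (π : Policy S A) : Measure (ℕ → S × A) :=
  Kernel.trajMeasure (X := fun _ => S × A) (stateAction ν π).toMeasure
    fun n => (M.stepKernel π).comap
      (fun h : (i : Finset.Iic n) → S × A => h ⟨n, Finset.mem_Iic.2 le_rfl⟩)
      (measurable_pi_apply _)

instance (ν : PMF S) (π : Policy S A) : IsProbabilityMeasure (M.lawFrom ν π) := by
  unfold lawFrom; infer_instance

/-- The law `P_π` of the trajectory generated by the policy `π`. -/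
noncomputable def law (π : Policy S A) : Measure (ℕ → S × A) := M.lawFrom M.init π

instance (π : Policy S A) : IsProbabilityMeasure (M.law π) := by
  unfold law; infer_instance

/-- The success probability `ρ(π) = P_π(R = 1)`. -/
noncomputable def successProb (π : Policy S A) : ℝ := (M.law π).real M.Success

/-- The value `V_π(s)`: the conditional probability of success given that the current state is `s`,
that is, the success probability of the trajectory started at `s`. -/
noncomputable def value (π : Policy S A) (s : S) : ℝ≥0∞ := M.lawFrom (PMF.pure s) π M.Success

/-- The law of the trajectory under `π`, conditioned on success. -/
noncomputable def successLaw (π : Policy S A) : Measure (ℕ → S × A) := (M.law π)[|M.Success]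

/-- The occupancy measure `d_π(s)`: the expected number of visits to `s` before the episode
ends. -/
noncomputable def occupancy (π : Policy S A) (s : S) : ℝ≥0∞ := ∫⁻ ω, M.visits s ω ∂M.law π

/-- The success-conditioned occupancy measure `d⁺_π(s)`. -/
noncomputable def successOccupancy (π : Policy S A) (s : S) : ℝ≥0∞ :=
  ∫⁻ ω, M.visits s ω ∂M.successLaw π

open Classical in
/-- The success-conditioned policy of `π₀`: in the state `s`, the conditional law under `π₀` of the
action taken in `s`, given that the trajectory (from `s` on) ends in success. Where success is
impossible the value is a convention. -/
noncomputable def successPolicy (π₀ : Policy S A) : Policy S A := fun s =>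
  if h : M.value π₀ s ≠ 0 then
    haveI : IsProbabilityMeasure ((M.lawFrom (PMF.pure s) π₀)[|M.Success]) :=
      cond_isProbabilityMeasure h
    haveI : IsProbabilityMeasure
        (((M.lawFrom (PMF.pure s) π₀)[|M.Success]).map fun ω => (ω 0).2) :=
      Measure.isProbabilityMeasure_map
        ((measurable_pi_apply 0).snd : Measurable fun ω : ℕ → S × A => (ω 0).2).aemeasurable
    (((M.lawFrom (PMF.pure s) π₀)[|M.Success]).map fun ω => (ω 0).2).toPMF
  else π₀ s

/-- The cross-entropy loss `ℓ(π)` of `π` on the successful trajectories of `π₀`: the expected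
next-action prediction loss of `π` under the law of `π₀` conditioned on success. -/
noncomputable def loss (π₀ π : Policy S A) : ℝ≥0∞ := ∫⁻ ω, M.trajLoss π ω ∂M.successLaw π₀

/-- The distribution-shift ratio: the supremum over the non-terminal states `s` of
`d_{π₊}(s) / d⁺_{π₀}(s)`, where `π₊` is the success-conditioned policy of `π₀`. A state at which
both occupancies vanish does not contribute (`0 / 0 = 0`), and `c / 0 = ∞` for `c > 0`. -/
noncomputable def shiftRatio (π₀ : Policy S A) : ℝ≥0∞ :=
  ⨆ s : S, ⨆ _ : s ∉ M.terminal,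
    M.occupancy (M.successPolicy π₀) s / M.successOccupancy π₀ s

end Law

end EpisodicMDP

/-! Write KL(s) for the relative entropy of `πhat s` from π₊(s), with π₊ in the first argument. Two
facts combine.

The excess loss is a sum of these entropies. By the Markov property, given success and a visit to s,
the action taken there has law π₊(s), and the successful occupancy is d⁺(s) = d(s) V(s) / ρ, with d,
V and ρ those of π₀ (`lintegral_successLaw_additive`). Splitting cross-entropy into entropy plus
relative entropy state by state gives Δ = ∑ d⁺(s) KL(s) (`loss_eq_add_relEntropy`), hence Δ ≥ 0.
Replacing d⁺ by the occupancy of π₊ costs at most the factor M (`occupancy_successPolicy_le`), so ∑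
d_{π₊}(s) KL(s) ≤ M Δ.

That last sum is the relative entropy of the stopped trajectory laws of π₊ and `πhat`, so Pinsker's
inequality for the success event finishes the proof. Path-space relative entropy is never formed.
For each exponent l, the Donsker–Varadhan bound l v ≤ log(1 - w + w eˡ) + D on the two success
probabilities v and w is carried through an induction on the horizon. It is stable under one random
step (`MGFBound.mix`), which plays the role of the chain rule. Hoeffding's lemma and the best l then
give 2(v - w)² ≤ D, and the horizon tends to infinity. -/

/-! ### First-step decomposition of a Markov chain law -/

section MarkovChain

variable {X : Type*}

/-- Prepend a value to a sequence. -/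
def consSeq (x : X) (ω : ℕ → X) : ℕ → X
  | 0 => x
  | n + 1 => ω n

variable [MeasurableSpace X]

lemma measurable_consSeq (x : X) : Measurable (consSeq x) := by
  refine measurable_pi_iff.2 fun n => ?_
  cases n with
  | zero => exact measurable_const
  | succ n => exact measurable_pi_apply n

/-- The law of the Markov chain with initial law `μ` and transition kernel `κ`. -/
noncomputable def chainLaw (μ : Measure X) (κ : Kernel X X) [IsMarkovKernel κ] :
    Measure (ℕ → X) :=
  Kernel.trajMeasure (X := fun _ => X) μ
    fun n => κ.comap
      (fun h : (i : Finset.Iic n) → X => h ⟨n, Finset.mem_Iic.2 le_rfl⟩)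
      (measurable_pi_apply _)

instance (μ : Measure X) [IsProbabilityMeasure μ] (κ : Kernel X X) [IsMarkovKernel κ] :
    IsProbabilityMeasure (chainLaw μ κ) := by
  unfold chainLaw; infer_instance

variable (μ : Measure X) (κ : Kernel X X) [IsMarkovKernel κ]

lemma chainLaw_map_eval_zero : (chainLaw μ κ).map (fun ω => ω 0) = μ := by
  have h : (fun ω : ℕ → X => ω 0) =
      (fun h : (i : Finset.Iic 0) → X => h ⟨0, Finset.mem_Iic.2 le_rfl⟩) ∘
        Preorder.frestrictLe (π := fun _ => X) 0 := rfl
  rw [h, ← Measure.map_map (by fun_prop) (by fun_prop), chainLaw, Kernel.trajMeasure,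
    Measure.map_comp _ _ (by fun_prop), Kernel.traj_map_frestrictLe, Kernel.partialTraj_self,
    Measure.id_comp, Measure.map_map (by fun_prop) (by fun_prop)]
  exact Measure.map_id

variable [MeasurableSingletonClass X] [IsProbabilityMeasure μ]

lemma chainLaw_cylinder (z : ℕ → X) (n : ℕ) :
    chainLaw μ κ {ω | ∀ i ≤ n, ω i = z i} =
      μ {z 0} * ∏ i ∈ Finset.range n, κ (z i) {z (i + 1)} := by
  induction n with
  | zero =>
    have h := congrArg (fun m : Measure X => m {z 0}) (chainLaw_map_eval_zero μ κ)
    beta_reduce at h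
    rw [Measure.map_apply (by fun_prop) (measurableSet_singleton _)] at h
    simp only [Finset.range_zero, Finset.prod_empty, mul_one, ← h]
    congr 1
    ext ω
    simp
  | succ n ih =>
    have key := congrArg
      (fun m : Measure (((i : Finset.Iic n) → X) × X) =>
        m ({Preorder.frestrictLe (π := fun _ => X) n z} ×ˢ {z (n + 1)}))
      (Kernel.map_frestrictLe_trajMeasure_compProd_eq_map_trajMeasure (X := fun _ => X)
        (μ₀ := μ) (a := n) (κ := fun n => κ.comap
          (fun h : (i : Finset.Iic n) → X => h ⟨n, Finset.mem_Iic.2 le_rfl⟩)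
          (measurable_pi_apply _)))
    beta_reduce at key
    rw [Measure.compProd_apply_prod (measurableSet_singleton _) (measurableSet_singleton _),
      lintegral_singleton,
      Measure.map_apply (by fun_prop) (measurableSet_singleton _),
      Measure.map_apply (by fun_prop)
        ((measurableSet_singleton _).prod (measurableSet_singleton _))] at key
    have h1 : Preorder.frestrictLe (π := fun _ => X) n ⁻¹'
        {Preorder.frestrictLe (π := fun _ => X) n z} = {ω | ∀ i ≤ n, ω i = z i} := by
      ext ω
      simp [funext_iff]
    have h2 : (fun x : ℕ → X => (Preorder.frestrictLe (π := fun _ => X) n x, x (n + 1))) ⁻¹'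
        ({Preorder.frestrictLe (π := fun _ => X) n z} ×ˢ {z (n + 1)}) =
        {ω | ∀ i ≤ n + 1, ω i = z i} := by
      ext ω
      simp only [Set.mem_preimage, Set.mem_prod, Set.mem_singleton_iff, funext_iff,
        Preorder.frestrictLe_apply, Subtype.forall, Finset.mem_Iic, Set.mem_ofPred_eq]
      constructor
      · rintro ⟨h, h'⟩ i hi
        rcases Nat.le_succ_iff.1 hi with h'' | rfl
        exacts [h i h'', h']
      · exact fun h => ⟨fun i hi => h i (by omega), h _ le_rfl⟩
    rw [h1, h2] at key
    rw [Finset.prod_range_succ, ← mul_assoc, ← ih, mul_comm]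
    exact key.symm

variable [Countable X]

/-- A finite measure on sequences is the unique projective limit of its marginals. Every finite
index set lies in an initial segment, and on a countable space the marginal there is determined by
its atoms. -/
lemma measure_seq_ext {P Q : Measure (ℕ → X)} [IsFiniteMeasure P] [IsFiniteMeasure Q]
    (h : ∀ (z : ℕ → X) (n : ℕ), P {ω | ∀ i ≤ n, ω i = z i} = Q {ω | ∀ i ≤ n, ω i = z i}) :
    P = Q := by
  have hP : IsProjectiveLimit (α := fun _ : ℕ => X) P fun I => P.map I.restrict := fun I => rfl
  refine hP.unique ?_
  intro I
  have : ∀ n : ℕ, P.map (Preorder.frestrictLe (π := fun _ => X) n) =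
      Q.map (Preorder.frestrictLe (π := fun _ => X) n) := by
    intro n
    refine Measure.ext_of_singleton fun y => ?_
    rw [Measure.map_apply (by fun_prop) (measurableSet_singleton _),
      Measure.map_apply (by fun_prop) (measurableSet_singleton _)]
    -- The finite history `y` is extended to a whole sequence by freezing it after time `n`; hence
    -- `min i n`.
    have h1 : Preorder.frestrictLe (π := fun _ => X) n ⁻¹' {y} =
        {ω | ∀ i ≤ n, ω i = y ⟨min i n, Finset.mem_Iic.2 (min_le_right _ _)⟩} := by
      ext ω
      simp only [Set.mem_preimage, Set.mem_singleton_iff, funext_iff,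
        Preorder.frestrictLe_apply, Subtype.forall, Finset.mem_Iic, Set.mem_ofPred_eq]
      refine forall₂_congr fun i hi => ?_
      simp [min_eq_left hi]
    rw [h1]
    exact h (fun i => y ⟨min i n, Finset.mem_Iic.2 (min_le_right _ _)⟩) n
  obtain ⟨n, hn⟩ : ∃ n, I ⊆ Finset.Iic n :=
    ⟨I.sup id, fun i hi => Finset.mem_Iic.2 (Finset.le_sup (f := id) hi)⟩
  have hI : I.restrict (π := fun _ => X) =
      (Finset.restrict₂ (π := fun _ => X) hn) ∘ Preorder.frestrictLe (π := fun _ => X) n := rfl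
  change Q.map _ = P.map _
  rw [hI, ← Measure.map_map (by fun_prop) (by fun_prop),
    ← Measure.map_map (by fun_prop) (by fun_prop), this n]

/-- Decomposition of the law of a Markov chain according to its first step. -/
lemma chainLaw_eq_sum :
    chainLaw μ κ = Measure.sum fun x => μ {x} • (chainLaw (κ x) κ).map (consSeq x) := by
  have hprob : IsProbabilityMeasure
      (Measure.sum fun x => μ {x} • (chainLaw (κ x) κ).map (consSeq x)) := by
    constructor
    rw [Measure.sum_apply _ MeasurableSet.univ]
    simp only [Measure.smul_apply, smul_eq_mul,
      Measure.map_apply (measurable_consSeq _) MeasurableSet.univ, Set.preimage_univ,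
      measure_univ, mul_one]
    have := lintegral_countable' (μ := μ) (fun _ => 1)
    simpa using this.symm
  refine measure_seq_ext fun z n => ?_
  have hmeas : MeasurableSet {ω : ℕ → X | ∀ i ≤ n, ω i = z i} := by
    simp only [Set.ofPred_forall]
    exact MeasurableSet.iInter fun i => MeasurableSet.iInter fun _ =>
      measurable_pi_apply i (measurableSet_singleton _)
  rw [Measure.sum_apply _ hmeas, tsum_eq_single (z 0)]
  · rw [Measure.smul_apply, Measure.map_apply (measurable_consSeq _) hmeas, smul_eq_mul]
    cases n with
    | zero =>
      have : consSeq (z 0) ⁻¹' {ω : ℕ → X | ∀ i ≤ 0, ω i = z i} = Set.univ := by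
        ext ω; simp [consSeq]
      rw [this, measure_univ, chainLaw_cylinder]
      simp
    | succ n =>
      have : consSeq (z 0) ⁻¹' {ω : ℕ → X | ∀ i ≤ n + 1, ω i = z i} =
          {ω | ∀ i ≤ n, ω i = z (i + 1)} := by
        ext ω
        simp only [Set.mem_preimage, Set.mem_ofPred_eq]
        constructor
        · exact fun h i hi => h (i + 1) (by omega)
        · rintro h (_ | i) hi
          exacts [rfl, h i (by omega)]
      rw [this, chainLaw_cylinder, chainLaw_cylinder (κ (z 0)) κ (fun i => z (i + 1)),
        Finset.prod_range_succ']
      ring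
  · intro x hx
    rw [Measure.smul_apply, Measure.map_apply (measurable_consSeq _) hmeas]
    have : consSeq x ⁻¹' {ω : ℕ → X | ∀ i ≤ n, ω i = z i} = ∅ := by
      ext ω
      simp only [Set.mem_preimage, Set.mem_ofPred_eq, Set.mem_empty_iff_false, iff_false]
      exact fun h => hx (h 0 (Nat.zero_le _))
    simp [this]

lemma lintegral_chainLaw {f : (ℕ → X) → ℝ≥0∞} (hf : Measurable f) :
    ∫⁻ ω, f ω ∂chainLaw μ κ = ∑' x, μ {x} * ∫⁻ ω, f (consSeq x ω) ∂chainLaw (κ x) κ := by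
  rw [chainLaw_eq_sum, lintegral_sum_measure]
  refine tsum_congr fun x => ?_
  rw [lintegral_smul_measure, lintegral_map hf (measurable_consSeq x), smul_eq_mul]

end MarkovChain

/-! ### First-step and Markov properties of the decision process -/

namespace EpisodicMDP

section FirstStep

variable {S A : Type*}

@[simp] lemma running_zero (M : EpisodicMDP S A) (ω : ℕ → S × A) :
    M.Running ω 0 ↔ (ω 0).1 ∉ M.terminal := by
  simp [Running]

@[simp] lemma running_consSeq_succ (M : EpisodicMDP S A) (x : S × A) (ω : ℕ → S × A) (t : ℕ) :
    M.Running (consSeq x ω) (t + 1) ↔ x.1 ∉ M.terminal ∧ M.Running ω t := by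
  constructor
  · exact fun h => ⟨h 0 (Nat.zero_le _), fun k hk => h (k + 1) (by omega)⟩
  · rintro ⟨h0, h⟩ (_ | k) hk
    exacts [h0, h k (by omega)]

/-- The event that the episode ends in success at one of the times `0, …, n`. -/
def SuccessBy (M : EpisodicMDP S A) (n : ℕ) : Set (ℕ → S × A) :=
  {ω | ∃ m ≤ n, (∀ k < m, (ω k).1 ∉ M.terminal) ∧ (ω m).1 ∈ M.success}

lemma mem_successBy_of_terminal (M : EpisodicMDP S A) {ω : ℕ → S × A} (n : ℕ)
    (h : (ω 0).1 ∈ M.terminal) : ω ∈ M.SuccessBy n ↔ (ω 0).1 ∈ M.success := by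
  constructor
  · rintro ⟨_ | m, -, hm, hs⟩
    exacts [hs, absurd h (hm 0 (Nat.succ_pos _))]
  · exact fun hs => ⟨0, Nat.zero_le _, by simp, hs⟩

lemma consSeq_mem_successBy (M : EpisodicMDP S A) {x : S × A} (ω : ℕ → S × A) (n : ℕ)
    (h : x.1 ∉ M.terminal) : consSeq x ω ∈ M.SuccessBy (n + 1) ↔ ω ∈ M.SuccessBy n := by
  constructor
  · rintro ⟨_ | m, hmn, hm, hs⟩
    · exact absurd (M.success_subset hs) h
    · exact ⟨m, by omega, fun k hk => hm (k + 1) (by omega), hs⟩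
  · rintro ⟨m, hmn, hm, hs⟩
    refine ⟨m + 1, by omega, ?_, hs⟩
    rintro (_ | k) hk
    exacts [h, hm k (by omega)]

lemma success_eq_iUnion (M : EpisodicMDP S A) : M.Success = ⋃ n, M.SuccessBy n := by
  ext ω
  simp only [Success, SuccessBy, Set.mem_iUnion, Set.mem_ofPred_eq]
  exact ⟨fun ⟨n, h⟩ => ⟨n, n, le_rfl, h⟩, fun ⟨_, m, _, h⟩ => ⟨m, h⟩⟩

lemma monotone_successBy (M : EpisodicMDP S A) : Monotone M.SuccessBy :=
  fun _ _ h _ ⟨m, hm, h'⟩ => ⟨m, hm.trans h, h'⟩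

/-- Before the episode ends, success is decided by the future alone. This is what allows the Markov
property to be applied under conditioning on success. -/
lemma mem_success_iff_shift (M : EpisodicMDP S A) {ω : ℕ → S × A} {t : ℕ} (h : M.Running ω t) :
    ω ∈ M.Success ↔ (fun n => ω (t + n)) ∈ M.Success := by
  constructor
  · rintro ⟨n, hn, hs⟩
    have htn : t ≤ n := by
      by_contra! hlt
      exact h n hlt.le (M.success_subset hs)
    refine ⟨n - t, fun k hk => hn _ (by omega), ?_⟩
    simpa only [Nat.add_sub_cancel' htn] using hs
  · rintro ⟨n, hn, hs⟩
    refine ⟨t + n, fun k hk => ?_, hs⟩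
    rcases le_or_gt k t with hkt | hkt
    · exact h k hkt
    · have := hn (k - t) (by omega)
      simpa only [Nat.add_sub_cancel' hkt.le] using this

lemma consSeq_mem_success (M : EpisodicMDP S A) {x : S × A} (ω : ℕ → S × A)
    (h : x.1 ∉ M.terminal) : consSeq x ω ∈ M.Success ↔ ω ∈ M.Success := by
  simp only [success_eq_iUnion, Set.mem_iUnion]
  constructor
  · rintro ⟨n, hn⟩
    exact ⟨n, (M.consSeq_mem_successBy ω n h).1 (M.monotone_successBy n.le_succ hn)⟩
  · rintro ⟨n, hn⟩
    exact ⟨n + 1, (M.consSeq_mem_successBy ω n h).2 hn⟩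

lemma stateAction_apply (ν : PMF S) (π : Policy S A) (x : S × A) :
    stateAction ν π x = ν x.1 * π x.1 x.2 := by
  classical
  rw [stateAction, PMF.bind_apply, tsum_eq_single x.1]
  · rw [PMF.map_apply, tsum_eq_single x.2]
    · simp
    · intro a ha
      exact if_neg fun h => ha (congrArg Prod.snd h).symm
  · intro s hs
    rw [PMF.map_apply]
    convert mul_zero _
    rw [ENNReal.tsum_eq_zero]
    intro a
    exact if_neg fun h => hs (congrArg Prod.fst h).symm

variable [Countable S] [MeasurableSpace S] [MeasurableSingletonClass S] [MeasurableSpace A]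
  (M : EpisodicMDP S A)

lemma measurableSet_running (t : ℕ) : MeasurableSet {ω | M.Running ω t} := by
  simp only [Running, Set.ofPred_forall]
  exact MeasurableSet.iInter fun k => MeasurableSet.iInter fun _ =>
    (measurable_pi_apply k).fst (Set.to_countable M.terminal).measurableSet.compl

lemma measurableSet_successBy (n : ℕ) : MeasurableSet (M.SuccessBy n) := by
  simp only [SuccessBy, Set.ofPred_exists, Set.ofPred_and, Set.ofPred_forall]
  refine MeasurableSet.iUnion fun m => (MeasurableSet.const _).inter (MeasurableSet.inter ?_ ?_)
  · exact MeasurableSet.iInter fun k => MeasurableSet.iInter fun _ =>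
      (measurable_pi_apply k).fst (Set.to_countable M.terminal).measurableSet.compl
  · exact (measurable_pi_apply m).fst (Set.to_countable M.success).measurableSet

lemma measurableSet_success : MeasurableSet M.Success := by
  rw [success_eq_iUnion]
  exact MeasurableSet.iUnion M.measurableSet_successBy

lemma measurableSet_visit (t : ℕ) (s : S) :
    MeasurableSet {ω : ℕ → S × A | M.Running ω t ∧ (ω t).1 = s} :=
  (M.measurableSet_running t).inter ((measurable_pi_apply t).fst (measurableSet_singleton s))

variable [Countable A] [MeasurableSingletonClass A]

lemma lintegral_lawFrom (ν : PMF S) (π : Policy S A) {f : (ℕ → S × A) → ℝ≥0∞}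
    (hf : Measurable f) :
    ∫⁻ ω, f ω ∂M.lawFrom ν π =
      ∑' s, ν s * ∑' a, π s a * ∫⁻ ω, f (consSeq (s, a) ω) ∂M.lawFrom (M.trans s a) π := by
  have h := lintegral_chainLaw (stateAction ν π).toMeasure (M.stepKernel π) hf
  refine Eq.trans h ?_
  rw [ENNReal.tsum_prod']
  refine tsum_congr fun s => ?_
  rw [← ENNReal.tsum_mul_left]
  refine tsum_congr fun a => ?_
  rw [PMF.toMeasure_apply_singleton _ _ (measurableSet_singleton _), stateAction_apply, mul_assoc]
  rfl

lemma lintegral_lawFrom_pure (s : S) (π : Policy S A) {f : (ℕ → S × A) → ℝ≥0∞}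
    (hf : Measurable f) :
    ∫⁻ ω, f ω ∂M.lawFrom (PMF.pure s) π =
      ∑' a, π s a * ∫⁻ ω, f (consSeq (s, a) ω) ∂M.lawFrom (M.trans s a) π := by
  classical
  rw [lintegral_lawFrom M _ π hf, tsum_eq_single s]
  · simp
  · intro s' hs'
    simp [PMF.pure_apply, hs']

lemma lintegral_lawFrom_eq_tsum_pure (ν : PMF S) (π : Policy S A) {f : (ℕ → S × A) → ℝ≥0∞}
    (hf : Measurable f) :
    ∫⁻ ω, f ω ∂M.lawFrom ν π = ∑' s, ν s * ∫⁻ ω, f ω ∂M.lawFrom (PMF.pure s) π := by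
  rw [lintegral_lawFrom M ν π hf]
  exact tsum_congr fun s => by rw [lintegral_lawFrom_pure M s π hf]

lemma lawFrom_eq_tsum_pure (ν : PMF S) (π : Policy S A) {E : Set (ℕ → S × A)}
    (hE : MeasurableSet E) :
    M.lawFrom ν π E = ∑' s, ν s * M.lawFrom (PMF.pure s) π E := by
  have := lintegral_lawFrom_eq_tsum_pure M ν π (f := E.indicator 1)
    (measurable_one.indicator hE)
  simpa only [lintegral_indicator_one hE] using this

lemma lawFrom_pure_apply (s : S) (π : Policy S A) {E : Set (ℕ → S × A)}
    (hE : MeasurableSet E) :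
    M.lawFrom (PMF.pure s) π E =
      ∑' a, π s a * M.lawFrom (M.trans s a) π (consSeq (s, a) ⁻¹' E) := by
  have := lintegral_lawFrom_pure M s π (f := E.indicator 1)
    (measurable_one.indicator hE)
  rw [lintegral_indicator_one hE] at this
  rw [this]
  refine tsum_congr fun a => ?_
  rw [← lintegral_indicator_one (measurable_consSeq _ hE)]
  rfl

/-- The probability that the state at time `t` is `s` and the episode has not yet ended. -/
noncomputable def visitProb (ν : PMF S) (π : Policy S A) (t : ℕ) (s : S) : ℝ≥0∞ :=
  M.lawFrom ν π {ω | M.Running ω t ∧ (ω t).1 = s}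

open Classical in
lemma visitProb_zero (ν : PMF S) (π : Policy S A) (s : S) :
    M.visitProb ν π 0 s = if s ∈ M.terminal then 0 else ν s := by
  rw [visitProb, lawFrom_eq_tsum_pure M _ _ (M.measurableSet_visit 0 s)]
  simp_rw [lawFrom_pure_apply M _ _ (M.measurableSet_visit 0 s)]
  have : ∀ s' a, consSeq (s', a) ⁻¹' {ω : ℕ → S × A | M.Running ω 0 ∧ (ω 0).1 = s} =
      {_ω | s' ∉ M.terminal ∧ s' = s} := by
    intro s' a
    ext ω
    simp [consSeq]
  simp_rw [this]
  rw [tsum_eq_single s]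
  · by_cases hs : s ∈ M.terminal
    · simp [hs]
    · simp [hs, (π s).tsum_coe]
  · intro s' hs'
    simp [hs']

open Classical in
lemma visitProb_succ (ν : PMF S) (π : Policy S A) (t : ℕ) (s : S) :
    M.visitProb ν π (t + 1) s = ∑' s', ν s' * if s' ∈ M.terminal then 0 else
      ∑' a, π s' a * M.visitProb (M.trans s' a) π t s := by
  rw [visitProb, lawFrom_eq_tsum_pure M _ _ (M.measurableSet_visit _ s)]
  simp_rw [lawFrom_pure_apply M _ _ (M.measurableSet_visit _ s)]
  refine tsum_congr fun s' => ?_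
  by_cases hs : s' ∈ M.terminal
  · have : ∀ a, consSeq (s', a) ⁻¹' {ω : ℕ → S × A | M.Running ω (t + 1) ∧ (ω (t + 1)).1 = s} =
        ∅ := by
      intro a
      ext ω
      simp [hs]
    simp [hs, this]
  · have : ∀ a, consSeq (s', a) ⁻¹' {ω : ℕ → S × A | M.Running ω (t + 1) ∧ (ω (t + 1)).1 = s} =
        {ω | M.Running ω t ∧ (ω t).1 = s} := by
      intro a
      ext ω
      simp [hs, consSeq]
    simp [hs, this, visitProb]

/-- The Markov property at time `t`, on the event that the episode has not yet ended. -/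
lemma lintegral_running_shift (π : Policy S A) {f : (ℕ → S × A) → ℝ≥0∞} (hf : Measurable f)
    (t : ℕ) (ν : PMF S) :
    ∫⁻ ω, {ω | M.Running ω t}.indicator (fun ω => f fun n => ω (t + n)) ω ∂M.lawFrom ν π =
      ∑' s, M.visitProb ν π t s * ∫⁻ ω, f ω ∂M.lawFrom (PMF.pure s) π := by
  classical
  have hmeas : ∀ t, Measurable
      ({ω | M.Running ω t}.indicator (fun ω => f fun n => ω (t + n))) := fun t =>
    (hf.comp (measurable_pi_lambda _ fun n => measurable_pi_apply (t + n))).indicator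
      (M.measurableSet_running t)
  -- The first step is peeled off, not the last, so the induction hypothesis is used with the
  -- transition law as initial law.
  induction t generalizing ν with
  | zero =>
    rw [lintegral_lawFrom M ν π (hmeas 0)]
    refine tsum_congr fun s => ?_
    rw [visitProb_zero, lintegral_lawFrom_pure M s π hf]
    by_cases hs : s ∈ M.terminal
    · simp [hs, Set.indicator, consSeq]
    · simp [hs, Set.indicator, show ∀ a ω, consSeq (s, a) ω 0 = (s, a) from fun _ _ => rfl]
  | succ t ih =>
    rw [lintegral_lawFrom M ν π (hmeas (t + 1))]
    simp_rw [visitProb_succ, ← ENNReal.tsum_mul_right]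
    rw [ENNReal.tsum_comm]
    refine tsum_congr fun s => ?_
    simp_rw [mul_assoc]
    rw [ENNReal.tsum_mul_left]
    congr 1
    by_cases hs : s ∈ M.terminal
    · simp [hs, Set.indicator]
    · simp only [hs, if_false, ← ENNReal.tsum_mul_right]
      rw [ENNReal.tsum_comm]
      refine tsum_congr fun a => ?_
      simp_rw [mul_assoc]
      rw [ENNReal.tsum_mul_left, ← ih]
      congr 2
      ext ω
      simp only [Set.indicator, Set.mem_ofPred_eq, running_consSeq_succ, hs, not_false_eq_true,
        true_and]
      simp only [Nat.add_right_comm t 1, consSeq]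

lemma occupancy_eq_tsum (π : Policy S A) (s : S) :
    M.occupancy π s = ∑' t, M.visitProb M.init π t s := by
  classical
  have : ∀ ω, M.visits s ω = ∑' t, {ω | M.Running ω t ∧ (ω t).1 = s}.indicator 1 ω := by
    intro ω
    refine tsum_congr fun t => ?_
    simp [Set.indicator]
  simp_rw [occupancy, this]
  rw [lintegral_tsum fun t =>
    (measurable_one.indicator (M.measurableSet_visit t s)).aemeasurable]
  refine tsum_congr fun t => ?_
  rw [lintegral_indicator_one (M.measurableSet_visit t s)]
  rfl

/-- Summing the Markov property over time. -/
lemma tsum_lintegral_running_shift (π : Policy S A) {f : (ℕ → S × A) → ℝ≥0∞}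
    (hf : Measurable f) :
    ∑' t, ∫⁻ ω, {ω | M.Running ω t}.indicator (fun ω => f fun n => ω (t + n)) ω ∂M.law π =
      ∑' s, M.occupancy π s * ∫⁻ ω, f ω ∂M.lawFrom (PMF.pure s) π := by
  simp_rw [law, lintegral_running_shift M π hf, occupancy_eq_tsum, ← ENNReal.tsum_mul_right]
  rw [ENNReal.tsum_comm]

lemma visitProb_eq_zero_of_terminal (ν : PMF S) (π : Policy S A) (t : ℕ) {s : S}
    (hs : s ∈ M.terminal) : M.visitProb ν π t s = 0 := by
  have : {ω : ℕ → S × A | M.Running ω t ∧ (ω t).1 = s} = ∅ := by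
    ext ω
    simp only [Set.mem_ofPred_eq, Set.mem_empty_iff_false, iff_false]
    rintro ⟨h, rfl⟩
    exact h t le_rfl hs
  rw [visitProb, this, measure_empty]

lemma occupancy_eq_zero_of_terminal (π : Policy S A) {s : S} (hs : s ∈ M.terminal) :
    M.occupancy π s = 0 := by
  simp [occupancy_eq_tsum, visitProb_eq_zero_of_terminal, hs]

/-- Absolute continuity of the action laws propagates to the visited states. Applied to π₊ and π₀,
it shows that a state missed by π₀ is missed by π₊, so the shift ratio there is 0 / 0. -/
lemma visitProb_eq_zero_of_ac {π π' : Policy S A}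
    (h : ∀ s ∉ M.terminal, ∀ a, π s a = 0 → π' s a = 0) (t : ℕ) (ν : PMF S) (s : S)
    (h0 : M.visitProb ν π t s = 0) : M.visitProb ν π' t s = 0 := by
  classical
  induction t generalizing ν with
  | zero => rwa [visitProb_zero] at h0 ⊢
  | succ t ih =>
    rw [visitProb_succ, ENNReal.tsum_eq_zero] at h0 ⊢
    intro s'
    have h1 := h0 s'
    by_cases hs : s' ∈ M.terminal
    · simp [hs]
    · simp only [hs, if_false, mul_eq_zero, ENNReal.tsum_eq_zero] at h1 ⊢
      exact h1.imp id fun h2 a => (h2 a).imp (h s' hs a) (ih _)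

lemma occupancy_eq_zero_of_ac {π π' : Policy S A}
    (h : ∀ s ∉ M.terminal, ∀ a, π s a = 0 → π' s a = 0) (s : S)
    (h0 : M.occupancy π s = 0) : M.occupancy π' s = 0 := by
  rw [occupancy_eq_tsum, ENNReal.tsum_eq_zero] at h0 ⊢
  exact fun t => M.visitProb_eq_zero_of_ac h t _ s (h0 t)

end FirstStep

end EpisodicMDP

/-! ### Conditioning on success: occupancies and loss -/

namespace EpisodicMDP

/-- If T is the first terminal time, a running time t from which success comes within n steps
satisfies T - n ≤ t < T, and there are at most n of these. -/
lemma tsum_running_successBy_le {S A : Type*} (M : EpisodicMDP S A) (ω : ℕ → S × A) (n : ℕ) :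
    ∑' t, {ω | M.Running ω t}.indicator
      (fun ω => (M.SuccessBy n).indicator (1 : (ℕ → S × A) → ℝ≥0∞) fun n => ω (t + n)) ω ≤ n := by
  classical
  by_cases hT : ∃ k, (ω k).1 ∈ M.terminal
  · calc _ ≤ ∑' t, if t ∈ Finset.Ico (Nat.find hT - n) (Nat.find hT) then (1 : ℝ≥0∞) else 0 := by
          refine ENNReal.tsum_le_tsum fun t => ?_
          by_cases ht : M.Running ω t
          · by_cases hs : (fun n => ω (t + n)) ∈ M.SuccessBy n
            · have h1 : t < Nat.find hT := by
                by_contra! hle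
                exact ht _ hle (Nat.find_spec hT)
              obtain ⟨m, hm, -, hm'⟩ := hs
              have h2 : Nat.find hT ≤ t + m := Nat.find_min' hT (M.success_subset hm')
              rw [if_pos (Finset.mem_Ico.2 ⟨by omega, h1⟩)]
              exact Set.indicator_le_self' (fun _ _ => zero_le) _ |>.trans
                (Set.indicator_le_self' (fun _ _ => zero_le) _)
            · simp [Set.indicator, hs]
          · simp [Set.indicator, ht]
      _ = ((Finset.Ico (Nat.find hT - n) (Nat.find hT)).card : ℝ≥0∞) := by
          rw [tsum_eq_sum (s := Finset.Ico (Nat.find hT - n) (Nat.find hT))]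
          · rw [Finset.sum_ite_mem, Finset.inter_self]
            simp
          · intro t ht
            exact if_neg ht
      _ ≤ n := by
          rw [Nat.card_Ico]
          exact_mod_cast (by omega)
  · have : ∀ t, (fun n => ω (t + n)) ∉ M.SuccessBy n := by
      rintro t ⟨m, -, -, hm⟩
      exact hT ⟨_, M.success_subset hm⟩
    simp [Set.indicator, this]

section SuccessConditioning

variable {S A : Type*} [Countable S] [MeasurableSpace S] [MeasurableSingletonClass S]
  [Countable A] [MeasurableSpace A] [MeasurableSingletonClass A]
  (M : EpisodicMDP S A)

lemma value_le_one (π : Policy S A) (s : S) : M.value π s ≤ 1 := prob_le_one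

/-- Success together with first action `a`, for an episode starting at a non-terminal state. -/
lemma successPolicy_mul_value (π : Policy S A) {s : S} (hs : s ∉ M.terminal)
    (hV : M.value π s ≠ 0) (a : A) :
    M.value π s * M.successPolicy π s a =
      π s a * M.lawFrom (M.trans s a) π M.Success := by
  have hmeas : MeasurableSet {ω : ℕ → S × A | (ω 0).2 = a} :=
    (measurable_pi_apply 0).snd (measurableSet_singleton a)
  have h1 : M.successPolicy π s a = (M.lawFrom (PMF.pure s) π)[|M.Success]
      {ω | (ω 0).2 = a} := by
    rw [successPolicy, dif_pos hV, Measure.toPMF_apply,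
      Measure.map_apply (measurable_pi_apply 0).snd (measurableSet_singleton a)]
    rfl
  have h2 : M.lawFrom (PMF.pure s) π (M.Success ∩ {ω | (ω 0).2 = a}) =
      π s a * M.lawFrom (M.trans s a) π M.Success := by
    rw [lawFrom_pure_apply M s π (M.measurableSet_success.inter hmeas), tsum_eq_single a]
    · congr 2
      ext ω
      simp [consSeq_mem_success M ω (x := (s, a)) hs, consSeq]
    · intro a' ha'
      have : consSeq (s, a') ⁻¹' (M.Success ∩ {ω | (ω 0).2 = a}) = ∅ := by
        ext ω
        simp [consSeq, ha']
      rw [this, measure_empty, mul_zero]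
  rw [h1, cond_apply M.measurableSet_success, ← mul_assoc, h2]
  change M.value π s * (M.value π s)⁻¹ * _ = _
  rw [ENNReal.mul_inv_cancel hV (ne_top_of_le_ne_top ENNReal.one_ne_top (M.value_le_one π s)),
    one_mul]

lemma successPolicy_eq_zero (π : Policy S A) {s : S} (hs : s ∉ M.terminal)
    (hV : M.value π s ≠ 0) {a : A} (h : π s a = 0) : M.successPolicy π s a = 0 := by
  have := M.successPolicy_mul_value π hs hV a
  rw [h, zero_mul] at this
  exact (mul_eq_zero.1 this).resolve_left hV

lemma lintegral_success_first (π : Policy S A) {s : S} (hs : s ∉ M.terminal)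
    (hV : M.value π s ≠ 0) (g : S × A → ℝ≥0∞) :
    ∫⁻ ω, M.Success.indicator (fun ω => g (ω 0)) ω ∂M.lawFrom (PMF.pure s) π =
      M.value π s * ∑' a, M.successPolicy π s a * g (s, a) := by
  have hmeas : Measurable (M.Success.indicator (fun ω => g (ω 0))) :=
    ((measurable_of_countable g).comp (measurable_pi_apply 0)).indicator M.measurableSet_success
  rw [lintegral_lawFrom_pure M s π hmeas, ← ENNReal.tsum_mul_left]
  refine tsum_congr fun a => ?_
  rw [← mul_assoc, M.successPolicy_mul_value π hs hV, mul_assoc]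
  congr 1
  have : ∀ ω, M.Success.indicator (fun ω => g (ω 0)) (consSeq (s, a) ω) =
      M.Success.indicator (fun _ => g (s, a)) ω := by
    intro ω
    classical
    simp only [Set.indicator, consSeq_mem_success M ω (x := (s, a)) hs]
    rfl
  simp_rw [this]
  rw [lintegral_indicator_const M.measurableSet_success, mul_comm]

lemma lintegral_successLaw (π : Policy S A) (f : (ℕ → S × A) → ℝ≥0∞) :
    ∫⁻ ω, f ω ∂M.successLaw π =
      (M.law π M.Success)⁻¹ * ∫⁻ ω, M.Success.indicator f ω ∂M.law π := by
  rw [successLaw, ProbabilityTheory.cond, lintegral_smul_measure, smul_eq_mul,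
    lintegral_indicator M.measurableSet_success]

/-- The success indicator moves inside the sum over t and onto the trajectory shifted by t. The
Markov property then reduces each term to an episode started at s, where success contributes the
value and tilts the first action to the success-conditioned policy. Occupancy and loss are the two
instances used. -/
lemma lintegral_successLaw_additive (π : Policy S A)
    (hV : ∀ s, s ∉ M.terminal → M.value π s ≠ 0) (g : S × A → ℝ≥0∞) :
    ∫⁻ ω, ∑' t, {ω | M.Running ω t}.indicator (fun ω => g (ω t)) ω ∂M.successLaw π =
      ∑' s, (M.law π M.Success)⁻¹ * M.occupancy π s * M.value π s *
        ∑' a, M.successPolicy π s a * g (s, a) := by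
  classical
  have hmeas : Measurable (M.Success.indicator (fun ω => g (ω 0))) :=
    ((measurable_of_countable g).comp (measurable_pi_apply 0)).indicator M.measurableSet_success
  have h : ∀ ω, M.Success.indicator
      (fun ω => ∑' t, {ω | M.Running ω t}.indicator (fun ω => g (ω t)) ω) ω =
      ∑' t, {ω | M.Running ω t}.indicator
        (fun ω => M.Success.indicator (fun ω => g (ω 0)) fun n => ω (t + n)) ω := by
    intro ω
    by_cases hω : ω ∈ M.Success
    · rw [Set.indicator_of_mem hω]
      refine tsum_congr fun t => ?_
      by_cases ht : M.Running ω t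
      · have := (M.mem_success_iff_shift ht).1 hω
        simp [Set.indicator, ht, this]
      · simp [Set.indicator, ht]
    · rw [Set.indicator_of_notMem hω, eq_comm, ENNReal.tsum_eq_zero]
      intro t
      by_cases ht : M.Running ω t
      · have := mt (M.mem_success_iff_shift ht).2 hω
        simp [Set.indicator, this]
      · simp [Set.indicator, ht]
  rw [lintegral_successLaw]
  simp_rw [h]
  rw [lintegral_tsum, tsum_lintegral_running_shift M π hmeas, ← ENNReal.tsum_mul_left]
  · refine tsum_congr fun s => ?_
    by_cases hs : s ∈ M.terminal
    · simp [occupancy_eq_zero_of_terminal M π hs]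
    · rw [M.lintegral_success_first π hs (hV s hs)]
      ring
  · intro t
    exact ((hmeas.comp (measurable_pi_lambda _ fun n => measurable_pi_apply (t + n))).indicator
      (M.measurableSet_running t)).aemeasurable

lemma successOccupancy_eq (π : Policy S A) (hV : ∀ s, s ∉ M.terminal → M.value π s ≠ 0) (s : S) :
    M.successOccupancy π s = (M.law π M.Success)⁻¹ * M.occupancy π s * M.value π s := by
  classical
  have h : ∀ ω, M.visits s ω = ∑' t, {ω | M.Running ω t}.indicator
      (fun ω => (fun x : S × A => if x.1 = s then 1 else 0) (ω t)) ω := by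
    intro ω
    refine tsum_congr fun t => ?_
    by_cases h1 : M.Running ω t <;> by_cases h2 : (ω t).1 = s <;> simp [h1, h2]
  rw [successOccupancy, lintegral_congr h, lintegral_successLaw_additive M π hV
    fun x => if x.1 = s then 1 else 0, tsum_eq_single s]
  · simp [PMF.tsum_coe]
  · intro s' hs'
    simp [hs']

lemma loss_eq_tsum (π₀ π : Policy S A) (hV : ∀ s, s ∉ M.terminal → M.value π₀ s ≠ 0) :
    M.loss π₀ π = ∑' s, M.successOccupancy π₀ s *
      ∑' a, M.successPolicy π₀ s a * negLog (π s a) := by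
  classical
  have h : ∀ ω, M.trajLoss π ω = ∑' t, {ω | M.Running ω t}.indicator
      (fun ω => (fun x : S × A => negLog (π x.1 x.2)) (ω t)) ω := by
    intro ω
    refine tsum_congr fun t => ?_
    by_cases h1 : M.Running ω t <;> simp [h1]
  rw [loss, lintegral_congr h, lintegral_successLaw_additive M π₀ hV
    fun x => negLog (π x.1 x.2)]
  simp_rw [successOccupancy_eq M π₀ hV]

/-- From s, success within some n steps has probability p > 0. Each trajectory has at most n running
times followed by success within n steps, so the occupancy times p is at most n. -/
lemma occupancy_ne_top (π : Policy S A) {s : S} (hV : M.value π s ≠ 0) :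
    M.occupancy π s ≠ ∞ := by
  obtain ⟨n, hn⟩ : ∃ n, M.lawFrom (PMF.pure s) π (M.SuccessBy n) ≠ 0 := by
    by_contra! h
    refine hV ?_
    rw [value, success_eq_iUnion]
    exact measure_iUnion_null h
  have hmeas : Measurable ((M.SuccessBy n).indicator (1 : (ℕ → S × A) → ℝ≥0∞)) :=
    measurable_one.indicator (M.measurableSet_successBy n)
  have h1 := tsum_lintegral_running_shift M π hmeas
  have h2 : M.occupancy π s * M.lawFrom (PMF.pure s) π (M.SuccessBy n) ≤ n := by
    calc _ = M.occupancy π s * ∫⁻ ω, (M.SuccessBy n).indicator 1 ω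
            ∂M.lawFrom (PMF.pure s) π := by
          rw [lintegral_indicator_one (M.measurableSet_successBy n)]
      _ ≤ _ := ENNReal.le_tsum s
      _ = _ := h1.symm
      _ = _ := (lintegral_tsum fun t => ((hmeas.comp (measurable_pi_lambda _ fun n =>
          measurable_pi_apply (t + n))).indicator (M.measurableSet_running t)).aemeasurable).symm
      _ ≤ ∫⁻ _, (n : ℝ≥0∞) ∂M.law π := lintegral_mono fun ω => M.tsum_running_successBy_le ω n
      _ = n := by simp
  intro h
  rw [h, ENNReal.top_mul hn] at h2
  exact ENNReal.natCast_ne_top n (top_le_iff.1 h2)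

lemma visitProb_mul_value_le (π : Policy S A) (t : ℕ) (s : S) :
    M.visitProb M.init π t s * M.value π s ≤ M.law π M.Success := by
  classical
  have hmeas : Measurable (M.Success.indicator (1 : (ℕ → S × A) → ℝ≥0∞)) :=
    measurable_one.indicator M.measurableSet_success
  calc _ = M.visitProb M.init π t s * ∫⁻ ω, M.Success.indicator 1 ω
            ∂M.lawFrom (PMF.pure s) π := by
          rw [lintegral_indicator_one M.measurableSet_success]; rfl
    _ ≤ _ := ENNReal.le_tsum s
    _ = _ := (lintegral_running_shift M π hmeas t M.init).symm
    _ ≤ ∫⁻ ω, M.Success.indicator 1 ω ∂M.law π := by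
        refine lintegral_mono fun ω => ?_
        by_cases ht : M.Running ω t
        · simp [Set.indicator, ht, M.mem_success_iff_shift ht]
        · simp [Set.indicator, ht]
    _ = _ := lintegral_indicator_one M.measurableSet_success

/-- Positive values at non-terminal states do not force a positive success probability, since the
initial law may sit on failure states. One reachable state of positive value does. -/
lemma law_success_ne_zero_of_occupancy (π : Policy S A) {s : S} (hV : M.value π s ≠ 0)
    (h : M.occupancy π s ≠ 0) : M.law π M.Success ≠ 0 := by
  intro h0
  refine h ?_
  rw [occupancy_eq_tsum, ENNReal.tsum_eq_zero]
  intro t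
  have := M.visitProb_mul_value_le π t s
  rw [h0, nonpos_iff_eq_zero, mul_eq_zero] at this
  exact this.resolve_right hV

lemma occupancy_successPolicy_le (π : Policy S A)
    (hV : ∀ s, s ∉ M.terminal → M.value π s ≠ 0) (s : S) :
    M.occupancy (M.successPolicy π) s ≤ M.shiftRatio π * M.successOccupancy π s := by
  by_cases hs : s ∈ M.terminal
  · rw [occupancy_eq_zero_of_terminal M _ hs]
    exact zero_le
  by_cases h0 : M.occupancy π s = 0
  · rw [M.occupancy_eq_zero_of_ac
      (fun s hs _ ha => M.successPolicy_eq_zero π hs (hV s hs) ha) s h0]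
    exact zero_le
  have hρ := M.law_success_ne_zero_of_occupancy π (hV s hs) h0
  -- Clearing the denominator requires the successful occupancy to be neither 0 nor ∞, which its
  -- product formula gives.
  rw [← ENNReal.div_le_iff]
  · exact le_iSup₂ (f := fun s (_ : s ∉ M.terminal) =>
      M.occupancy (M.successPolicy π) s / M.successOccupancy π s) s hs
  · rw [successOccupancy_eq M π hV]
    exact mul_ne_zero (mul_ne_zero (ENNReal.inv_ne_zero.2 (measure_ne_top _ _)) h0) (hV s hs)
  · rw [successOccupancy_eq M π hV]
    exact ENNReal.mul_ne_top (ENNReal.mul_ne_top (ENNReal.inv_ne_top.2 hρ)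
      (M.occupancy_ne_top π (hV s hs))) (measure_ne_top _ _)

end SuccessConditioning

end EpisodicMDP

/-! ### Relative entropy, Gibbs and Hoeffding bounds, Pinsker's inequality -/

section RelativeEntropy

/-- The integrand `p log (p / q) + q - p` of the relative entropy, for `p, q ∈ [0, 1]`. -/
noncomputable def klTerm (p q : ℝ≥0∞) : ℝ≥0∞ :=
  open Classical in
  if p = 0 then q else if q = 0 then ∞ else
    ENNReal.ofReal (p.toReal * Real.log (p.toReal / q.toReal) + q.toReal - p.toReal)

/-- The relative entropy of two distributions on a discrete space. -/
noncomputable def relEntropy {α : Type*} (p q : PMF α) : ℝ≥0∞ := ∑' i, klTerm (p i) (q i)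

/-- This is log t ≤ t - 1 at t = y q / p, multiplied by p: the pointwise form of the Gibbs
inequality. -/
lemma mul_log_le_klTerm {p q : ℝ≥0∞} (hp : p ≤ 1) (hq : q ≤ 1) (h : klTerm p q ≠ ∞) {y : ℝ}
    (hy : 0 < y) :
    p.toReal * Real.log y ≤ (klTerm p q).toReal + q.toReal * y - q.toReal := by
  by_cases hp0 : p = 0
  · simp only [hp0, klTerm, if_true, ENNReal.toReal_zero, zero_mul, add_sub_cancel_left]
    positivity
  by_cases hq0 : q = 0
  · simp [klTerm, hp0, hq0] at h
  have hp' : 0 < p.toReal := ENNReal.toReal_pos hp0 (ne_top_of_le_ne_top ENNReal.one_ne_top hp)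
  have hq' : 0 < q.toReal := ENNReal.toReal_pos hq0 (ne_top_of_le_ne_top ENNReal.one_ne_top hq)
  have h1 : (klTerm p q).toReal ≥
      p.toReal * Real.log (p.toReal / q.toReal) + q.toReal - p.toReal := by
    rw [klTerm, if_neg hp0, if_neg hq0, ENNReal.toReal_ofReal']
    exact le_max_left _ _
  have h2 : Real.log (y * q.toReal / p.toReal) ≤ y * q.toReal / p.toReal - 1 :=
    Real.log_le_sub_one_of_pos (by positivity)
  have h3 := mul_le_mul_of_nonneg_left h2 hp'.le
  have h4 : p.toReal * (y * q.toReal / p.toReal - 1) = y * q.toReal - p.toReal := by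
    field_simp
  rw [Real.log_div (by positivity) (by positivity), Real.log_mul (by positivity) (by positivity),
    h4] at h3
  rw [Real.log_div (by positivity) (by positivity)] at h1
  linarith

lemma negLog_eq_ofReal {p : ℝ≥0∞} (hp : p ≤ 1) (h0 : p ≠ 0) :
    EpisodicMDP.negLog p = ENNReal.ofReal (-Real.log p.toReal) := by
  rw [EpisodicMDP.negLog, ENNReal.log_pos_real h0 (ne_top_of_le_ne_top ENNReal.one_ne_top hp),
    ← EReal.coe_neg, EReal.real_coe_toENNReal]

/-- The correction q - p in `klTerm` makes each term non-negative. Moving its two parts to opposite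
sides avoids subtraction in `ℝ≥0∞`; after summation both contribute 1 and cancel. -/
lemma mul_negLog_add {p q : ℝ≥0∞} (hp : p ≤ 1) (hq : q ≤ 1) :
    p * EpisodicMDP.negLog q + q = p * EpisodicMDP.negLog p + klTerm p q + p := by
  by_cases hp0 : p = 0
  · simp [hp0, klTerm]
  by_cases hq0 : q = 0
  · simp [klTerm, hp0, hq0, EpisodicMDP.negLog, ENNReal.mul_top]
  have hpt := ne_top_of_le_ne_top ENNReal.one_ne_top hp
  have hqt := ne_top_of_le_ne_top ENNReal.one_ne_top hq
  have hp' : 0 < p.toReal := ENNReal.toReal_pos hp0 hpt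
  have hq' : 0 < q.toReal := ENNReal.toReal_pos hq0 hqt
  have hlp : Real.log p.toReal ≤ 0 :=
    Real.log_nonpos hp'.le (ENNReal.toReal_mono ENNReal.one_ne_top hp)
  have hlq : Real.log q.toReal ≤ 0 :=
    Real.log_nonpos hq'.le (ENNReal.toReal_mono ENNReal.one_ne_top hq)
  have hnn : 0 ≤ p.toReal * Real.log (p.toReal / q.toReal) + q.toReal - p.toReal := by
    have h2 : Real.log (q.toReal / p.toReal) ≤ q.toReal / p.toReal - 1 :=
      Real.log_le_sub_one_of_pos (by positivity)
    have h3 := mul_le_mul_of_nonneg_left h2 hp'.le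
    have h4 : p.toReal * (q.toReal / p.toReal - 1) = q.toReal - p.toReal := by
      field_simp
    rw [Real.log_div (by positivity) (by positivity), h4] at h3
    rw [Real.log_div (by positivity) (by positivity)]
    linarith
  rw [negLog_eq_ofReal hq hq0, negLog_eq_ofReal hp hp0, klTerm, if_neg hp0, if_neg hq0]
  conv_lhs => rw [← ENNReal.ofReal_toReal hpt, ← ENNReal.ofReal_toReal hqt]
  conv_rhs => rw [← ENNReal.ofReal_toReal hpt]
  simp only [ENNReal.toReal_ofReal hp'.le, ENNReal.toReal_ofReal hq'.le]
  rw [← ENNReal.ofReal_mul hp'.le, ← ENNReal.ofReal_mul hp'.le,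
    ← ENNReal.ofReal_add (mul_nonneg hp'.le (by linarith)) hq'.le,
    ← ENNReal.ofReal_add (mul_nonneg hp'.le (by linarith)) hnn,
    ← ENNReal.ofReal_add (add_nonneg (mul_nonneg hp'.le (by linarith)) hnn) hp'.le,
    Real.log_div (by positivity) (by positivity)]
  congr 1
  ring

variable {α : Type*}

/-- Cross-entropy is entropy plus relative entropy. -/
lemma tsum_mul_negLog (p q : PMF α) :
    ∑' i, p i * EpisodicMDP.negLog (q i) =
      ∑' i, p i * EpisodicMDP.negLog (p i) + relEntropy p q := by
  have h : ∑' i, (p i * EpisodicMDP.negLog (q i) + q i) =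
      ∑' i, (p i * EpisodicMDP.negLog (p i) + klTerm (p i) (q i) + p i) :=
    tsum_congr fun i => mul_negLog_add (p.coe_le_one i) (q.coe_le_one i)
  rw [ENNReal.tsum_add, ENNReal.tsum_add, ENNReal.tsum_add, p.tsum_coe, q.tsum_coe] at h
  exact (ENNReal.add_left_inj ENNReal.one_ne_top).1 h

lemma relEntropy_self (p : PMF α) : relEntropy p p = 0 := by
  rw [relEntropy, ENNReal.tsum_eq_zero]
  intro i
  by_cases h : p i = 0
  · simp [klTerm, h]
  · have : 0 < (p i).toReal := ENNReal.toReal_pos h (p.apply_ne_top i)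
    simp [klTerm, h, div_self this.ne']

lemma summable_toReal_pmf (p : PMF α) : Summable fun i => (p i).toReal :=
  ENNReal.summable_toReal p.tsum_coe_ne_top

lemma tsum_toReal_pmf (p : PMF α) : ∑' i, (p i).toReal = 1 := by
  rw [← ENNReal.tsum_toReal_eq p.apply_ne_top, p.tsum_coe, ENNReal.toReal_one]

lemma summable_pmf_mul (p : PMF α) {x : α → ℝ} {B : ℝ} (hx : ∀ i, |x i| ≤ B) :
    Summable fun i => (p i).toReal * x i := by
  refine Summable.of_norm_bounded ((summable_toReal_pmf p).mul_right B) fun i => ?_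
  rw [norm_mul, Real.norm_eq_abs, Real.norm_eq_abs, abs_of_nonneg ENNReal.toReal_nonneg]
  exact mul_le_mul_of_nonneg_left (hx i) ENNReal.toReal_nonneg

/-- The Gibbs variational inequality. -/
lemma tsum_mul_log_le (p q : PMF α) {x : α → ℝ} {b B : ℝ} (hb : 0 < b) (hbx : ∀ i, b ≤ x i)
    (hxB : ∀ i, x i ≤ B) (hkl : relEntropy p q ≠ ∞) :
    ∑' i, (p i).toReal * Real.log (x i) ≤
      (relEntropy p q).toReal + Real.log (∑' i, (q i).toReal * x i) := by
  have hx0 : ∀ i, 0 < x i := fun i => hb.trans_le (hbx i)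
  have hsq : Summable fun i => (q i).toReal * x i :=
    summable_pmf_mul q fun i => by rw [abs_of_pos (hx0 i)]; exact hxB i
  set Z := ∑' i, (q i).toReal * x i with hZ
  have hbZ : b ≤ Z := by
    calc b = ∑' i, (q i).toReal * b := by rw [tsum_mul_right, tsum_toReal_pmf, one_mul]
      _ ≤ Z := ((summable_toReal_pmf q).mul_right b).tsum_le_tsum
          (fun i => mul_le_mul_of_nonneg_left (hbx i) ENNReal.toReal_nonneg) hsq
  have hZ0 : 0 < Z := hb.trans_le hbZ
  have hkl' : ∀ i, klTerm (p i) (q i) ≠ ∞ := ENNReal.ne_top_of_tsum_ne_top hkl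
  have hlog : Summable fun i => (p i).toReal * Real.log (x i) :=
    summable_pmf_mul p (B := max |Real.log b| |Real.log B|) fun i =>
      abs_le_max_abs_abs (Real.log_le_log hb (hbx i)) (Real.log_le_log (hx0 i) (hxB i))
  have key : ∀ i, (p i).toReal * Real.log (x i) ≤ (klTerm (p i) (q i)).toReal +
      ((q i).toReal * x i * Z⁻¹ - (q i).toReal + (p i).toReal * Real.log Z) := by
    intro i
    -- Normalizing to y = x i / Z makes y have mean 1 under q, so the terms q y - q sum to zero.
    have := mul_log_le_klTerm (p.coe_le_one i) (q.coe_le_one i) (hkl' i) (div_pos (hx0 i) hZ0)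
    rw [Real.log_div (hx0 i).ne' hZ0.ne', div_eq_mul_inv] at this
    linarith
  have s1 : Summable fun i => (klTerm (p i) (q i)).toReal := ENNReal.summable_toReal hkl
  have s2 := (hsq.mul_right Z⁻¹).sub (summable_toReal_pmf q)
  have s3 := (summable_toReal_pmf p).mul_right (Real.log Z)
  calc _ ≤ _ := hlog.tsum_le_tsum key (s1.add (s2.add s3))
    _ = _ := by
      rw [s1.tsum_add (s2.add s3), s2.tsum_add s3,
        (hsq.mul_right Z⁻¹).tsum_sub (summable_toReal_pmf q), tsum_mul_right, tsum_mul_right,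
        tsum_toReal_pmf, tsum_toReal_pmf, ← hZ, mul_inv_cancel₀ hZ0.ne', relEntropy,
        ENNReal.tsum_toReal_eq hkl']
      ring

/-- Hoeffding's lemma for a Bernoulli distribution. -/
lemma log_bernoulli_mgf_le {w : ℝ} (hw0 : 0 ≤ w) (hw1 : w ≤ 1) (l : ℝ) :
    Real.log (1 - w + w * Real.exp l) ≤ l * w + l ^ 2 / 8 := by
  let μ : Measure ℝ := ENNReal.ofReal (1 - w) • Measure.dirac 0 + ENNReal.ofReal w •
    Measure.dirac 1
  have hint : ∀ f : ℝ → ℝ, ∫ x, f x ∂μ = (1 - w) * f 0 + w * f 1 := by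
    intro f
    have hf : ∀ (c a : ℝ), Integrable f (ENNReal.ofReal c • Measure.dirac a) := fun c a =>
      (integrable_dirac (by simp)).smul_measure ENNReal.ofReal_ne_top
    rw [integral_add_measure (hf _ _) (hf _ _), integral_smul_measure, integral_smul_measure,
      integral_dirac, integral_dirac, ENNReal.toReal_ofReal hw0,
      ENNReal.toReal_ofReal (by linarith)]
    rfl
  have : IsProbabilityMeasure μ := by
    constructor
    simp only [μ, Measure.add_apply, Measure.smul_apply, measure_univ, smul_eq_mul, mul_one]
    rw [← ENNReal.ofReal_add (by linarith) hw0]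
    simp
  have hae : ∀ᵐ x ∂μ, id x ∈ Set.Icc (0 : ℝ) 1 := by
    refine ae_add_measure_iff.2 ⟨Measure.ae_smul_measure ?_ _, Measure.ae_smul_measure ?_ _⟩
    · rw [ae_dirac_eq]; simp
    · rw [ae_dirac_eq]; simp
  -- The variance proxy on [0, 1] is (1/2)², hence l² / 8. The bound concerns the centred variable;
  -- the factor exp(l w) below undoes the centring.
  have h := (hasSubgaussianMGF_of_mem_Icc (μ := μ) aemeasurable_id hae).mgf_le l
  rw [mgf, hint, hint] at h
  have hpos : 0 < 1 - w + w * Real.exp l := by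
    rcases hw0.eq_or_lt with rfl | hw
    · simp
    · have := mul_pos hw (Real.exp_pos l)
      linarith
  have h1 : 1 - w + w * Real.exp l ≤ Real.exp (l * w + l ^ 2 / 8) := by
    have e : (1 - w + w * Real.exp l) = Real.exp (l * w) *
        ((1 - w) * Real.exp (l * (0 - w)) + w * Real.exp (l * (1 - w))) := by
      rw [mul_add, mul_left_comm, ← Real.exp_add, mul_left_comm, ← Real.exp_add]
      ring_nf
      simp only [Real.exp_zero]
      ring
    rw [e, Real.exp_add]
    refine mul_le_mul_of_nonneg_left ?_ (Real.exp_pos _).le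
    refine le_trans (le_of_eq ?_) (h.trans (le_of_eq ?_))
    · simp
    · congr 1
      norm_num
      ring
  exact (Real.log_le_iff_le_exp hpos).2 h1

/-- The Donsker–Varadhan bound at the exponent `l`: `v` and `w` are probabilities of an event
under two laws whose relative entropy is at most `D`. -/
def MGFBound (l : ℝ) (v w D : ℝ≥0∞) : Prop :=
  D ≠ ∞ → l * v.toReal ≤ Real.log (1 - w.toReal + w.toReal * Real.exp l) + D.toReal

lemma MGFBound.of_self {l : ℝ} {v : ℝ≥0∞} (D : ℝ≥0∞) (hv : v = 0 ∨ v = 1) :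
    MGFBound l v v D := by
  intro _
  rcases hv with rfl | rfl
  · simp
  · simp

/-- Average the individual bounds over p, then move from p to q by the Gibbs inequality for x i = 1
- w i + w i eˡ, at the cost of `relEntropy p q`. Since x is affine in w, its q-mean is the same
expression in the averaged w. -/
lemma MGFBound.mix {l : ℝ} (p q : PMF α) {v w D : α → ℝ≥0∞} (hv : ∀ i, v i ≤ 1)
    (hw : ∀ i, w i ≤ 1) (h : ∀ i, MGFBound l (v i) (w i) (D i)) :
    MGFBound l (∑' i, p i * v i) (∑' i, q i * w i) (relEntropy p q + ∑' i, p i * D i) := by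
  intro htop
  obtain ⟨hkl, hD⟩ := ENNReal.add_ne_top.1 htop
  have hw' : ∀ i, (w i).toReal ≤ 1 := fun i => ENNReal.toReal_mono ENNReal.one_ne_top (hw i)
  have hv' : ∀ i, (v i).toReal ≤ 1 := fun i => ENNReal.toReal_mono ENNReal.one_ne_top (hv i)
  have hDi := ENNReal.ne_top_of_tsum_ne_top hD
  have hvi : ∀ i, p i * v i ≠ ∞ := fun i => ENNReal.mul_ne_top (p.apply_ne_top i)
    (ne_top_of_le_ne_top ENNReal.one_ne_top (hv i))
  have hwi : ∀ i, q i * w i ≠ ∞ := fun i => ENNReal.mul_ne_top (q.apply_ne_top i)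
    (ne_top_of_le_ne_top ENNReal.one_ne_top (hw i))
  set x : α → ℝ := fun i => 1 - (w i).toReal + (w i).toReal * Real.exp l with hx
  have hbx : ∀ i, min 1 (Real.exp l) ≤ x i := by
    intro i
    have h0 : 0 ≤ (w i).toReal := ENNReal.toReal_nonneg
    have h1 := mul_le_mul_of_nonneg_left (min_le_right 1 (Real.exp l)) h0
    have h2 := mul_le_mul_of_nonneg_left (min_le_left 1 (Real.exp l)) (sub_nonneg.2 (hw' i))
    simp only [hx]
    linarith
  have hxB : ∀ i, x i ≤ max 1 (Real.exp l) := by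
    intro i
    have h0 : 0 ≤ (w i).toReal := ENNReal.toReal_nonneg
    have h1 := mul_le_mul_of_nonneg_left (le_max_right 1 (Real.exp l)) h0
    have h2 := mul_le_mul_of_nonneg_left (le_max_left 1 (Real.exp l)) (sub_nonneg.2 (hw' i))
    simp only [hx]
    linarith
  have hb : 0 < min 1 (Real.exp l) := lt_min one_pos (Real.exp_pos l)
  have gibbs := tsum_mul_log_le p q hb hbx hxB hkl
  have sw : Summable fun i => (q i).toReal * (w i).toReal :=
    summable_pmf_mul q (B := 1) fun i => by
      rw [abs_of_nonneg ENNReal.toReal_nonneg]; exact hw' i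
  have sv : Summable fun i => (p i).toReal * (v i).toReal :=
    summable_pmf_mul p (B := 1) fun i => by
      rw [abs_of_nonneg ENNReal.toReal_nonneg]; exact hv' i
  have hZ : ∑' i, (q i).toReal * x i = 1 - (∑' i, q i * w i).toReal +
      (∑' i, q i * w i).toReal * Real.exp l := by
    rw [ENNReal.tsum_toReal_eq hwi]
    simp only [ENNReal.toReal_mul]
    rw [← tsum_toReal_pmf q, ← (summable_toReal_pmf q).tsum_sub sw, ← tsum_mul_right,
      ← ((summable_toReal_pmf q).sub sw).tsum_add (sw.mul_right _)]
    exact tsum_congr fun i => by simp only [hx]; ring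
  have slog : Summable fun i => (p i).toReal * Real.log (x i) :=
    summable_pmf_mul p fun i => abs_le_max_abs_abs (Real.log_le_log hb (hbx i))
      (Real.log_le_log (hb.trans_le (hbx i)) (hxB i))
  have sD : Summable fun i => (p i * D i).toReal := ENNReal.summable_toReal hD
  have step : ∑' i, l * ((p i).toReal * (v i).toReal) ≤
      ∑' i, ((p i).toReal * Real.log (x i) + (p i * D i).toReal) := by
    refine (sv.mul_left l).tsum_le_tsum (fun i => ?_) (slog.add sD)
    -- Where p vanishes, `D i` may be infinite and its bound vacuous, but the term has no weight.
    by_cases hp : p i = 0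
    · simp [hp]
    · have hDt : D i ≠ ∞ := fun ht => hDi i (by rw [ht, ENNReal.mul_top hp])
      have := mul_le_mul_of_nonneg_left (h i hDt) (ENNReal.toReal_nonneg (a := p i))
      rw [ENNReal.toReal_mul]
      simp only [hx]
      linarith
  rw [tsum_mul_left, slog.tsum_add sD] at step
  rw [ENNReal.toReal_add hkl hD, ENNReal.tsum_toReal_eq hvi, ENNReal.tsum_toReal_eq hDi, ← hZ]
  simp only [ENNReal.toReal_mul] at step ⊢
  linarith

/-- With Hoeffding's lemma the bound reads l (v - w) - l² / 8 ≤ D; the left side is largest at l = 4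
(v - w). -/
lemma two_mul_sq_sub_le {v w D : ℝ≥0∞} (hw : w ≤ 1) (hD : D ≠ ∞)
    (h : ∀ l, MGFBound l v w D) : 2 * (v.toReal - w.toReal) ^ 2 ≤ D.toReal := by
  have h1 := h (4 * (v.toReal - w.toReal)) hD
  have h2 := log_bernoulli_mgf_le (ENNReal.toReal_nonneg (a := w))
    (ENNReal.toReal_mono ENNReal.one_ne_top hw) (4 * (v.toReal - w.toReal))
  linarith

end RelativeEntropy

/-! ### Comparison of two policies along the trajectory -/

namespace EpisodicMDP

section Comparison

variable {S A : Type*} [Countable S] [MeasurableSpace S] [MeasurableSingletonClass S]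
  [MeasurableSpace A] (M : EpisodicMDP S A)

lemma measurable_running_state (h : S → ℝ≥0∞) (t : ℕ) :
    Measurable ({ω : ℕ → S × A | M.Running ω t}.indicator (fun ω => h (ω t).1)) :=
  ((measurable_of_countable h).comp (measurable_pi_apply t).fst).indicator
    (M.measurableSet_running t)

lemma measurable_sum_running_state (h : S → ℝ≥0∞) (n : ℕ) :
    Measurable fun ω : ℕ → S × A =>
      ∑ t ∈ Finset.range n, {ω | M.Running ω t}.indicator (fun ω => h (ω t).1) ω :=
  Finset.measurable_sum _ fun t _ => M.measurable_running_state h t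

variable [Countable A] [MeasurableSingletonClass A]

/-- The expectation of the sum of `h` over the non-terminal states visited before time `n`. -/
noncomputable def partialCost (π : Policy S A) (h : S → ℝ≥0∞) (n : ℕ) (ν : PMF S) : ℝ≥0∞ :=
  ∫⁻ ω, ∑ t ∈ Finset.range n, {ω | M.Running ω t}.indicator (fun ω => h (ω t).1) ω
    ∂M.lawFrom ν π

lemma partialCost_eq_tsum_pure (π : Policy S A) (h : S → ℝ≥0∞) (n : ℕ) (ν : PMF S) :
    M.partialCost π h n ν = ∑' s, ν s * M.partialCost π h n (PMF.pure s) :=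
  M.lintegral_lawFrom_eq_tsum_pure ν π (M.measurable_sum_running_state h n)

lemma partialCost_succ (π : Policy S A) (h : S → ℝ≥0∞) (n : ℕ) {s : S} (hs : s ∉ M.terminal) :
    M.partialCost π h (n + 1) (PMF.pure s) =
      h s + ∑' a, π s a * M.partialCost π h n (M.trans s a) := by
  classical
  rw [partialCost, lintegral_lawFrom_pure M s π (M.measurable_sum_running_state h (n + 1))]
  have : ∀ a ω, ∑ t ∈ Finset.range (n + 1), {ω : ℕ → S × A | M.Running ω t}.indicator
        (fun ω => h (ω t).1) (consSeq (s, a) ω) =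
      h s + ∑ t ∈ Finset.range n, {ω | M.Running ω t}.indicator (fun ω => h (ω t).1) ω := by
    intro a ω
    rw [Finset.sum_range_succ', add_comm]
    congr 1
    · simp [Set.indicator, show consSeq (s, a) ω 0 = (s, a) from rfl, hs]
    · refine Finset.sum_congr rfl fun t _ => ?_
      simp [Set.indicator, hs, show consSeq (s, a) ω (t + 1) = ω t from rfl]
  simp_rw [this]
  have : ∀ a, ∫⁻ ω, h s + ∑ t ∈ Finset.range n, {ω | M.Running ω t}.indicator
        (fun ω => h (ω t).1) ω ∂M.lawFrom (M.trans s a) π =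
      h s + M.partialCost π h n (M.trans s a) := by
    intro a
    rw [lintegral_add_left measurable_const]
    simp [partialCost]
  simp_rw [this, mul_add]
  rw [ENNReal.tsum_add, ENNReal.tsum_mul_right, PMF.tsum_coe, one_mul]

lemma partialCost_init_le (π : Policy S A) (h : S → ℝ≥0∞) (n : ℕ) :
    M.partialCost π h n M.init ≤ ∑' s, M.occupancy π s * h s := by
  have hmeas : Measurable fun ω : ℕ → S × A => h (ω 0).1 :=
    (measurable_of_countable h).comp (measurable_pi_apply 0).fst
  have hpure : ∀ s, ∫⁻ ω, h (ω 0).1 ∂M.lawFrom (PMF.pure s) π = h s := by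
    intro s
    rw [lintegral_lawFrom_pure M s π hmeas]
    simp only [consSeq, lintegral_const, measure_univ, mul_one]
    rw [ENNReal.tsum_mul_right, PMF.tsum_coe, one_mul]
  have key := tsum_lintegral_running_shift M π hmeas
  simp_rw [hpure] at key
  rw [← key, partialCost, lintegral_finsetSum _ fun t _ => M.measurable_running_state h t]
  exact ENNReal.sum_le_tsum _

/-- The base cases of the induction: at a terminal state or horizon 0 the outcome is already
decided, whatever the policy. -/
lemma lawFrom_pure_successBy_eq_zero_or_one (π : Policy S A) (n : ℕ) (s : S)
    (h : s ∈ M.terminal ∨ n = 0) :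
    (∀ π' : Policy S A, M.lawFrom (PMF.pure s) π' (M.SuccessBy n) =
      M.lawFrom (PMF.pure s) π (M.SuccessBy n)) ∧
    (M.lawFrom (PMF.pure s) π (M.SuccessBy n) = 0 ∨
      M.lawFrom (PMF.pure s) π (M.SuccessBy n) = 1) := by
  classical
  have key : ∀ π : Policy S A, M.lawFrom (PMF.pure s) π (M.SuccessBy n) =
      if s ∈ M.success then 1 else 0 := by
    intro π
    have : ∀ a, consSeq (s, a) ⁻¹' M.SuccessBy n = {_ω | s ∈ M.success} := by
      intro a
      ext ω
      rcases h with h | rfl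
      · exact M.mem_successBy_of_terminal (ω := consSeq (s, a) ω) n h
      · simp [SuccessBy, consSeq]
    simp_rw [lawFrom_pure_apply M s π (M.measurableSet_successBy n), this]
    by_cases hs : s ∈ M.success
    · simp [hs, PMF.tsum_coe]
    · simp [hs]
  refine ⟨fun π' => by rw [key, key], ?_⟩
  rw [key]
  by_cases hs : s ∈ M.success <;> simp [hs]

lemma lawFrom_pure_successBy_succ (π : Policy S A) (n : ℕ) {s : S} (hs : s ∉ M.terminal) :
    M.lawFrom (PMF.pure s) π (M.SuccessBy (n + 1)) =
      ∑' a, π s a * M.lawFrom (M.trans s a) π (M.SuccessBy n) := by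
  rw [lawFrom_pure_apply M s π (M.measurableSet_successBy _)]
  refine tsum_congr fun a => ?_
  congr 2
  ext ω
  exact M.consSeq_mem_successBy (x := (s, a)) ω n hs

/-- Both processes draw the state from the same law, so this mixing costs no relative entropy; only
the choice of actions does. -/
lemma mgfBound_lawFrom (l : ℝ) (π π' : Policy S A) (h : S → ℝ≥0∞) (n : ℕ)
    (hpure : ∀ s, MGFBound l (M.lawFrom (PMF.pure s) π (M.SuccessBy n))
      (M.lawFrom (PMF.pure s) π' (M.SuccessBy n)) (M.partialCost π h n (PMF.pure s)))
    (ν : PMF S) :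
    MGFBound l (M.lawFrom ν π (M.SuccessBy n)) (M.lawFrom ν π' (M.SuccessBy n))
      (M.partialCost π h n ν) := by
  rw [lawFrom_eq_tsum_pure M ν π (M.measurableSet_successBy n),
    lawFrom_eq_tsum_pure M ν π' (M.measurableSet_successBy n), partialCost_eq_tsum_pure]
  have := MGFBound.mix ν ν (fun _ => prob_le_one) (fun _ => prob_le_one) hpure
  rwa [relEntropy_self, zero_add] at this

/-- The relative entropy between the trajectory laws of two policies up to time `n` is the
expected sum of the relative entropies of their action distributions; the event of success by
time `n` obeys the corresponding Donsker–Varadhan bound. -/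
lemma mgfBound_successBy (l : ℝ) (π π' : Policy S A) (n : ℕ) (s : S) :
    MGFBound l (M.lawFrom (PMF.pure s) π (M.SuccessBy n))
      (M.lawFrom (PMF.pure s) π' (M.SuccessBy n))
      (M.partialCost π (fun s => relEntropy (π s) (π' s)) n (PMF.pure s)) := by
  induction n generalizing s with
  | zero =>
    obtain ⟨h1, h2⟩ := M.lawFrom_pure_successBy_eq_zero_or_one π 0 s (Or.inr rfl)
    rw [h1 π']
    exact MGFBound.of_self _ h2
  | succ n ih =>
    by_cases hs : s ∈ M.terminal
    · obtain ⟨h1, h2⟩ := M.lawFrom_pure_successBy_eq_zero_or_one π (n + 1) s (Or.inl hs)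
      rw [h1 π']
      exact MGFBound.of_self _ h2
    · rw [lawFrom_pure_successBy_succ M π n hs, lawFrom_pure_successBy_succ M π' n hs,
        partialCost_succ M _ _ n hs]
      exact MGFBound.mix _ _ (fun _ => prob_le_one) (fun _ => prob_le_one)
        fun a => M.mgfBound_lawFrom l π π' _ n ih _

/-- Pinsker's inequality for the success event of two policies. -/
lemma two_mul_sq_successProb_sub_le (π π' : Policy S A)
    (hD : ∑' s, M.occupancy π s * relEntropy (π s) (π' s) ≠ ∞) :
    2 * (M.successProb π - M.successProb π') ^ 2 ≤
      (∑' s, M.occupancy π s * relEntropy (π s) (π' s)).toReal := by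
  have hlim : ∀ π : Policy S A, Filter.Tendsto (fun n => (M.law π).real (M.SuccessBy n))
      Filter.atTop (nhds (M.successProb π)) := by
    intro π
    rw [successProb, success_eq_iUnion]
    exact (ENNReal.tendsto_toReal (measure_ne_top _ _)).comp
      (tendsto_measure_iUnion_atTop M.monotone_successBy)
  -- The bound at each finite horizon has a right side independent of n. Letting n grow needs no
  -- assumption that episodes end.
  refine le_of_tendsto ((((hlim π).sub (hlim π')).pow 2).const_mul 2)
    (Filter.Eventually.of_forall fun n => ?_)
  have hle := M.partialCost_init_le π (fun s => relEntropy (π s) (π' s)) n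
  exact (two_mul_sq_sub_le prob_le_one (ne_top_of_le_ne_top hD hle) fun l =>
    M.mgfBound_lawFrom l π π' _ n (M.mgfBound_successBy l π π' n) M.init).trans
    (ENNReal.toReal_mono hD hle)

lemma loss_eq_add_relEntropy (π₀ π : Policy S A)
    (hV : ∀ s, s ∉ M.terminal → M.value π₀ s ≠ 0) :
    M.loss π₀ π = M.loss π₀ (M.successPolicy π₀) +
      ∑' s, M.successOccupancy π₀ s * relEntropy (M.successPolicy π₀ s) (π s) := by
  rw [loss_eq_tsum M π₀ π hV, loss_eq_tsum M π₀ _ hV, ← ENNReal.tsum_add]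
  refine tsum_congr fun s => ?_
  rw [tsum_mul_negLog, mul_add]

end Comparison

end EpisodicMDP

theorem proposition4 {S A : Type*}
    [Countable S] [MeasurableSpace S] [MeasurableSingletonClass S]
    [Countable A] [MeasurableSpace A] [MeasurableSingletonClass A]
    (M : EpisodicMDP S A) (π₀ πhat : EpisodicMDP.Policy S A)
    (hsucc : ∀ s, s ∉ M.terminal → M.value π₀ s ≠ 0)
    (hloss : M.loss π₀ (M.successPolicy π₀) ≠ ∞) :
    M.loss π₀ (M.successPolicy π₀) ≤ M.loss π₀ πhat ∧
    ENNReal.ofReal |M.successProb πhat - M.successProb (M.successPolicy π₀)| ≤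
      (M.shiftRatio π₀ *
        (M.loss π₀ πhat - M.loss π₀ (M.successPolicy π₀)) / 2) ^ (1 / 2 : ℝ) := by
  have hadd := M.loss_eq_add_relEntropy π₀ πhat hsucc
  refine ⟨hadd ▸ le_self_add, ?_⟩
  have hexcess : M.loss π₀ πhat - M.loss π₀ (M.successPolicy π₀) =
      ∑' s, M.successOccupancy π₀ s * relEntropy (M.successPolicy π₀ s) (πhat s) := by
    -- Finiteness of the optimal loss is essential here: truncated subtraction gives ∞ - ∞ = 0.
    rw [hadd, ENNReal.add_sub_cancel_left hloss]
  have hshift : ∑' s, M.occupancy (M.successPolicy π₀) s *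
        relEntropy (M.successPolicy π₀ s) (πhat s) ≤
      M.shiftRatio π₀ * (M.loss π₀ πhat - M.loss π₀ (M.successPolicy π₀)) := by
    rw [hexcess, ← ENNReal.tsum_mul_left]
    refine ENNReal.tsum_le_tsum fun s => ?_
    rw [← mul_assoc]
    exact mul_le_mul_left (M.occupancy_successPolicy_le π₀ hsucc s) _
  set B := M.shiftRatio π₀ * (M.loss π₀ πhat - M.loss π₀ (M.successPolicy π₀)) with hB
  by_cases htop : B = ∞
  · rw [htop, ENNReal.top_div_of_ne_top (by norm_num), ENNReal.top_rpow_of_pos (by norm_num)]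
    exact le_top
  have hpinsker := (M.two_mul_sq_successProb_sub_le (M.successPolicy π₀) πhat
    (ne_top_of_le_ne_top htop hshift)).trans (ENNReal.toReal_mono htop hshift)
  rw [one_div, ENNReal.le_rpow_inv_iff (by norm_num), ENNReal.rpow_ofNat,
    ← ENNReal.ofReal_pow (abs_nonneg _), sq_abs,
    ENNReal.le_div_iff_mul_le (by norm_num) (by norm_num)]
  calc _ = ENNReal.ofReal
        (2 * (M.successProb (M.successPolicy π₀) - M.successProb πhat) ^ 2) := by
        rw [← ENNReal.ofReal_ofNat 2, ← ENNReal.ofReal_mul (sq_nonneg _)]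
        congr 1
        ring
    _ ≤ ENNReal.ofReal B.toReal := ENNReal.ofReal_le_ofReal hpinsker
    _ = B := ENNReal.ofReal_toReal htop
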